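/- Let $A$ be a Gaussian quantum system with $n$ modes, with Hilbert space $L^2(\mathbb R^n)$ carrying the Schrödinger representation of the canonical commutation relations $[Q^k,P^l]=i\,\delta^{kl}$, and let $M$ be a quantum system (an arbitrary complex Hilbert space). For $\mathbf x=(q^k,p^k)_{k=1}^n\in\mathbb R^{2n}$ let $D_A(\mathbf x)=\exp\big(i\sum_k(p^kQ^k-q^kP^k)\big)$ be the displacement operators, which satisfy $D_A(\mathbf x)^\dagger Q^kD_A(\mathbf x)=Q^k+q^k$ and $D_A(\mathbf x)^\dagger P^kD_A(\mathbf x)=P^k+p^k$. For $t>0$ let $p_t(\mathbf x)=(2\pi t)^{-n}e^{-|\mathbf x|^2/(2t)}$, and let $$(\mathcal N_A(t)\otimes\mathbb I_M)(\rho)=\int_{\mathbb R^{2n}}D_A(\mathbf x)\,\rho\,D_A(\mathbf x)^\dagger\,p_t(\mathbf x)\,d\mathbf x\quad(t>0),\qquad \mathcal N_A(0)=\mathbb I_A .$$ Let $S(\rho)=-\mathrm{Tr}[\rho\ln\rho]\in[0,\infty]$ be the von Neumann entropy, and let $S(Y|M)=S(YM)-S(M)$. Let $\rho_{AM}$ be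 a quantum state (a positive operator with unit trace) on $AM$ such that $S(\rho_{AM})<\infty$ and $S(\rho_M)<\infty$, where $\rho_M=\mathrm{Tr}_A\,\rho_{AM}$. For $t>0$ let $\sigma_{AMX}(t)$ be the state on $AM$ together with a classical random variable $X$ with values in $\mathbb R^{2n}$, such that $X$ has probability density $p_t$ and $\sigma_{AM|X=\mathbf x}(t)=D_A(\mathbf x)\,\rho_{AM}\,D_A(\mathbf x)^\dagger$; its density is $\omega(\mathbf x)=p_t(\mathbf x)\,D_A(\mathbf x)\,\rho_{AM}\,D_A(\mathbf x)^\dagger$. The entropy of a joint state of a quantum system and $X$ with density $\omega$ is $-\int\mathrm{Tr}[\omega(\mathbf x)\ln\omega(\mathbf x)]\,d\mathbf x$. Define the integral conditional Fisher information by $$\Delta_{A|M}(\rho_{AM})(t)=I(A:X|M)_{\sigma_{AMX}(t)}=\big(S(A|M)+S(X|M)-S(AX|M)\big)_{\sigma_{AMX}(t)}\quad(t>0),\qquad \Delta_{A|M}(\rho_{AM})(0)=0 .$$ Then for every $t\ge0$, as an identity in $(-\infty,+\infty]$, $$\Delta_{A|M}(\rho_{AM})(t)=S(A|M)_{(\mathcal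 N_A(t)\otimes\mathbb I_M)(\rho_{AM})}-S(A|M)_{\rho_{AM}} .$$ -/

import Mathlib

open MeasureTheory
open scoped ENNReal

noncomputable section

namespace QuantumDeBruijn

/-! ## Traces, states and entropies on a complex Hilbert space -/

theorem tsum_norm_sq_eq {H : Type*} [NormedAddCommGroup H] [InnerProductSpace ℂ H] {ι : Type*}
    (b : HilbertBasis ι ℂ H) (v : H) :
    ∑' i, ENNReal.ofReal (‖inner ℂ (b i) v‖ ^ 2) = ENNReal.ofReal (‖v‖ ^ 2) := by
  have h := (RCLike.reCLM (K := ℂ)).hasSum (b.hasSum_inner_mul_inner v v)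
  have e1 : (RCLike.reCLM (K := ℂ)) (inner ℂ v v) = ‖v‖ ^ 2 := by
    rw [RCLike.reCLM_apply, inner_self_eq_norm_sq]
  have e2 : ∀ i, (RCLike.reCLM (K := ℂ)) (inner ℂ v (b i) * inner ℂ (b i) v) =
      ‖inner ℂ (b i) v‖ ^ 2 := by
    intro i
    rw [← inner_conj_symm v (b i), RCLike.conj_mul, RCLike.reCLM_apply, ← RCLike.ofReal_pow,
      RCLike.ofReal_re]
  simp only [e1, e2] at h
  rw [← ENNReal.ofReal_tsum_of_nonneg (fun i => by positivity) h.summable, h.tsum_eq]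

section Entropy

variable {H : Type*} [NormedAddCommGroup H] [InnerProductSpace ℂ H] [CompleteSpace H]

/-- The index set of a (chosen) orthonormal basis of `H`. -/
def basisIndex (H : Type*) [NormedAddCommGroup H] [InnerProductSpace ℂ H] [CompleteSpace H] :
    Set H :=
  (exists_hilbertBasis ℂ H).choose

/-- A (chosen) orthonormal basis of the Hilbert space `H`. -/
def basis (H : Type*) [NormedAddCommGroup H] [InnerProductSpace ℂ H] [CompleteSpace H] :
    HilbertBasis (basisIndex H) ℂ H :=
  (exists_hilbertBasis ℂ H).choose_spec.choose

/-- The trace `Tr T = ∑ᵢ ⟨eᵢ, T eᵢ⟩ ∈ [0, ∞]` of a positive bounded operator `T`; it does not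
depend on the orthonormal basis, see `trace_eq_tsum`. -/
def trace (T : H →L[ℂ] H) : ℝ≥0∞ :=
  ∑' i, ENNReal.ofReal (RCLike.re (inner ℂ (basis H i) (T (basis H i))))

theorem tsum_norm_sq_adjoint {ι κ : Type*} (b : HilbertBasis ι ℂ H) (c : HilbertBasis κ ℂ H)
    (S : H →L[ℂ] H) :
    ∑' i, ENNReal.ofReal (‖S (c i)‖ ^ 2) =
      ∑' j, ENNReal.ofReal (‖(ContinuousLinearMap.adjoint S) (b j)‖ ^ 2) := by
  calc ∑' i, ENNReal.ofReal (‖S (c i)‖ ^ 2)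
      = ∑' i, ∑' j, ENNReal.ofReal (‖inner ℂ (b j) (S (c i))‖ ^ 2) := by
        simp only [tsum_norm_sq_eq b]
    _ = ∑' j, ∑' i, ENNReal.ofReal (‖inner ℂ (b j) (S (c i))‖ ^ 2) := ENNReal.tsum_comm
    _ = ∑' j, ∑' i,
          ENNReal.ofReal (‖inner ℂ (c i) ((ContinuousLinearMap.adjoint S) (b j))‖ ^ 2) := by
        simp only [ContinuousLinearMap.adjoint_inner_right, norm_inner_symm]
    _ = _ := by simp only [tsum_norm_sq_eq c]

/-- The trace of a positive operator can be computed in any orthonormal basis. -/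
theorem trace_eq_tsum {ι : Type*} (b : HilbertBasis ι ℂ H) {T : H →L[ℂ] H} (hT : T.IsPositive) :
    trace T = ∑' i, ENNReal.ofReal (RCLike.re (inner ℂ (b i) (T (b i)))) := by
  obtain ⟨S, hS⟩ := (CStarAlgebra.nonneg_iff_eq_star_mul_self (a := T)).1
    ((ContinuousLinearMap.nonneg_iff_isPositive T).2 hT)
  have key : ∀ v : H, RCLike.re (inner ℂ v (T v)) = ‖S v‖ ^ 2 := by
    intro v
    have h1 : T v = (ContinuousLinearMap.adjoint S) (S v) := by
      rw [hS, ContinuousLinearMap.star_eq_adjoint]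
      rfl
    rw [h1, ContinuousLinearMap.adjoint_inner_right, inner_self_eq_norm_sq]
  unfold trace
  simp only [key]
  rw [tsum_norm_sq_adjoint b (basis H) S, tsum_norm_sq_adjoint b b S]

/-- Quantum states: positive operators with unit trace. -/
def IsState (ρ : H →L[ℂ] H) : Prop :=
  ρ.IsPositive ∧ trace ρ = 1

/-- The von Neumann entropy `S(ρ) = -Tr[ρ ln ρ] ∈ [0, ∞]` of a quantum state. The operator
`-ρ ln ρ` is given by the continuous functional calculus for `s ↦ -s ln s`; it is positive, since
`0 ≤ ρ ≤ 1`. -/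
def entropy (ρ : H →L[ℂ] H) : ℝ≥0∞ :=
  trace (cfc Real.negMulLog ρ)

/-- The entropy of a joint state of a quantum system with Hilbert space `H` and of a classical
random variable `X` with values in `E`. The state is given by its density `ω` with respect to the
reference measure `dx` of `E`: if `X` has probability density `f` and the conditional states are
`σ_x`, then `ω x = f x • σ_x`. The entropy is `-∫ Tr[ω x ln (ω x)] dx`, the integral of the positive
part minus the integral of the negative part, since `-s ln s` is negative for `s > 1`. For `H = ℂ` this is
the Shannon differential entropy of `X`. -/
def cqEntropy {E : Type*} [MeasureSpace E] (ω : E → (H →L[ℂ] H)) : EReal :=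
  ((∫⁻ x, trace (cfc (fun s : ℝ => max (Real.negMulLog s) 0) (ω x)) : ℝ≥0∞) : EReal) -
    ((∫⁻ x, trace (cfc (fun s : ℝ => max (-Real.negMulLog s) 0) (ω x)) : ℝ≥0∞) : EReal)

end Entropy

/-! ## The Gaussian quantum system `A` and the memory `M` -/

/-- The `n`-dimensional configuration space. -/
abbrev Config (n : ℕ) : Type := EuclideanSpace ℝ (Fin n)

/-- The phase space `ℝ²ⁿ`, with its Euclidean norm and Lebesgue measure. The coordinate `x (k, 0)`
is the shift of the position `Q^k`, and `x (k, 1)` is the shift of the momentum `P^k`. -/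
abbrev Phase (n : ℕ) : Type := EuclideanSpace ℝ (Fin n × Fin 2)

/-- The Hilbert space `L²(ℝⁿ) ⊗ F`, realized as the space `L²(ℝⁿ; F)` of square integrable
`F`-valued functions. For `F = ℂ` it is the Hilbert space `L²(ℝⁿ)` of a Gaussian quantum system with
`n` modes, that is, the Schrödinger representation of the canonical commutation relations (`Q^k` is
the multiplication by the `k`-th coordinate, and `P^k = -i ∂/∂y_k`). -/
abbrev Joint (n : ℕ) (F : Type*) [NormedAddCommGroup F] [InnerProductSpace ℂ F] : Type _ :=
  Lp F 2 (volume : Measure (Config n))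

section System

variable {n : ℕ} {F : Type*} [NormedAddCommGroup F] [InnerProductSpace ℂ F]

/-- The product vector `e ⊗ u`, the function `y ↦ e(y) u`, as a linear function of `u`. -/
def tensorLeft (e : Joint n ℂ) : F →L[ℂ] Joint n F :=
  LinearMap.mkContinuous
    { toFun := fun u => (ContinuousLinearMap.toSpanSingleton ℂ u).compLp e
      map_add' := fun u v => by
        rw [ContinuousLinearMap.toSpanSingleton_add, ContinuousLinearMap.add_compLp]
      map_smul' := fun c u => by
        rw [RingHom.id_apply, ContinuousLinearMap.toSpanSingleton_smul,
          ContinuousLinearMap.smul_compLp] }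
    ‖e‖ (fun u => by
      refine (ContinuousLinearMap.norm_compLp_le _ _).trans ?_
      rw [ContinuousLinearMap.norm_toSpanSingleton, mul_comm])

theorem coeFn_tensorLeft (e : Joint n ℂ) (u : F) :
    tensorLeft e u =ᵐ[volume] fun y => e y • u :=
  (ContinuousLinearMap.toSpanSingleton ℂ u).coeFn_compLp' e

/-- The partial trace over `A`, `Tr_A T = ∑ᵢ (⟨eᵢ| ⊗ 1) T (|eᵢ⟩ ⊗ 1)`, for a trace class operator
`T` on `AM`; here `(eᵢ)` is an orthonormal basis of the Hilbert space `L²(ℝⁿ)` of `A`. -/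
def partialTrace [CompleteSpace F] (T : Joint n F →L[ℂ] Joint n F) : F →L[ℂ] F :=
  ∑' i, ContinuousLinearMap.adjoint (tensorLeft (basis (Joint n ℂ) i)) ∘L T ∘L
    tensorLeft (basis (Joint n ℂ) i)

theorem norm_phase_smul (θ : Config n → ℝ) (y : Config n) (v : F) :
    ‖Complex.exp ((θ y : ℂ) * Complex.I) • v‖ = ‖v‖ := by
  rw [norm_smul, Complex.norm_exp_ofReal_mul_I, one_mul]

theorem memLp_phase (θ : Config n → ℝ) (hθ : Continuous θ) (ψ : Joint n F) :
    MemLp (fun y => Complex.exp ((θ y : ℂ) * Complex.I) • ψ y) 2 volume :=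
  (Lp.memLp ψ).of_le
    (((by fun_prop : Continuous fun y => Complex.exp ((θ y : ℂ) * Complex.I)
      ).aestronglyMeasurable).smul (Lp.aestronglyMeasurable ψ))
    (Filter.Eventually.of_forall fun y => (norm_phase_smul θ y _).le)

/-- Multiplication by the phase factor `exp(i θ(y))`. -/
def phaseMul (θ : Config n → ℝ) (hθ : Continuous θ) : Joint n F →ₗᵢ[ℂ] Joint n F :=
  { toFun := fun ψ => (memLp_phase θ hθ ψ).toLp _
    map_add' := fun ψ φ => by
      rw [← MemLp.toLp_add]
      refine MemLp.toLp_congr _ _ ?_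
      filter_upwards [Lp.coeFn_add ψ φ] with y hy
      rw [hy, Pi.add_apply, Pi.add_apply, smul_add]
    map_smul' := fun c ψ => by
      rw [RingHom.id_apply, ← MemLp.toLp_const_smul]
      refine MemLp.toLp_congr _ _ ?_
      filter_upwards [Lp.coeFn_smul c ψ] with y hy
      rw [hy, Pi.smul_apply, Pi.smul_apply, smul_comm]
    norm_map' := fun ψ => by
      change ‖(memLp_phase θ hθ ψ).toLp _‖ = ‖ψ‖
      rw [Lp.norm_toLp, Lp.norm_def]
      congr 1
      exact eLpNorm_congr_norm_ae (Filter.Eventually.of_forall fun y => norm_phase_smul θ y _) }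

theorem coeFn_phaseMul (θ : Config n → ℝ) (hθ : Continuous θ) (ψ : Joint n F) :
    phaseMul θ hθ ψ =ᵐ[volume] fun y => Complex.exp ((θ y : ℂ) * Complex.I) • ψ y :=
  MemLp.coeFn_toLp (memLp_phase θ hθ ψ)

/-- The position part of a phase space vector. -/
def posPart (x : Phase n) : Config n := WithLp.toLp 2 fun k => x (k, 0)

/-- The momentum part of a phase space vector. -/
def momPart (x : Phase n) : Config n := WithLp.toLp 2 fun k => x (k, 1)

/-- The phase `p · (y - q / 2)` of the displacement by `x = (q, p)`. -/
def displacementPhase (x : Phase n) (y : Config n) : ℝ :=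
  inner ℝ (momPart x) (y - (2⁻¹ : ℝ) • posPart x)

theorem continuous_displacementPhase (x : Phase n) : Continuous (displacementPhase x) := by
  unfold displacementPhase
  fun_prop

/-- The displacement operator `D(x) = exp(i ∑ₖ (pᵏ Qᵏ - qᵏ Pᵏ))` for `x = (q, p)`, acting on `A`:
`(D(x) ψ)(y) = exp(i p · (y - q / 2)) ψ(y - q)`. On `L²(ℝⁿ; F) = L²(ℝⁿ) ⊗ F` this is the operator
`D(x) ⊗ 1`, see `displacement_tensorLeft`. -/
def displacement (x : Phase n) : Joint n F →L[ℂ] Joint n F :=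
  ((phaseMul (displacementPhase x) (continuous_displacementPhase x)).comp
    (Lp.compMeasurePreservingₗᵢ ℂ (fun y : Config n => y - posPart x)
      (measurePreserving_sub_right volume (posPart x)))).toContinuousLinearMap

theorem coeFn_displacement (x : Phase n) (ψ : Joint n F) :
    displacement x ψ =ᵐ[volume] fun y =>
      Complex.exp ((displacementPhase x y : ℂ) * Complex.I) • ψ (y - posPart x) := by
  refine (coeFn_phaseMul (displacementPhase x) (continuous_displacementPhase x)
    (Lp.compMeasurePreservingₗᵢ ℂ (fun y : Config n => y - posPart x)
      (measurePreserving_sub_right volume (posPart x)) ψ)).trans ?_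
  filter_upwards [Lp.coeFn_compMeasurePreserving ψ
    (measurePreserving_sub_right volume (posPart x))] with y hy
  exact congrArg _ hy

/-- `D(x)` acts on the first tensor factor only. -/
theorem displacement_tensorLeft (x : Phase n) (e : Joint n ℂ) (u : F) :
    displacement x (tensorLeft e u) = tensorLeft (displacement x e) u := by
  refine Lp.ext ?_
  filter_upwards [coeFn_displacement x (tensorLeft e u), coeFn_displacement x e,
    coeFn_tensorLeft (displacement x e) u,
    (measurePreserving_sub_right volume (posPart x)).quasiMeasurePreserving.ae
      (coeFn_tensorLeft e u)] with y h1 h2 h3 h4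
  rw [h1, h3, h2, h4, smul_eq_mul, mul_smul]

/-- The Weyl form of the canonical commutation relations. -/
theorem displacement_displacement (x z : Phase n) (ψ : Joint n F) :
    displacement x (displacement z ψ) =
      Complex.exp ((((inner ℝ (momPart x) (posPart z) - inner ℝ (momPart z) (posPart x)) / 2 : ℝ)
        : ℂ) * Complex.I) • displacement (x + z) ψ := by
  have hp : posPart (x + z) = posPart x + posPart z := rfl
  have hm : momPart (x + z) = momPart x + momPart z := rfl
  refine Lp.ext ?_
  filter_upwards [coeFn_displacement x (displacement z ψ), coeFn_displacement (x + z) ψ,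
    Lp.coeFn_smul (Complex.exp ((((inner ℝ (momPart x) (posPart z) -
      inner ℝ (momPart z) (posPart x)) / 2 : ℝ) : ℂ) * Complex.I)) (displacement (x + z) ψ),
    (measurePreserving_sub_right volume (posPart x)).quasiMeasurePreserving.ae
      (coeFn_displacement z ψ)] with y h1 h2 h3 h4
  rw [h1, h3, h4, Pi.smul_apply, h2, smul_smul, smul_smul, ← Complex.exp_add, ← Complex.exp_add,
    hp, sub_sub]
  congr 2
  rw [← add_mul, ← add_mul, ← Complex.ofReal_add, ← Complex.ofReal_add]
  congr 2
  simp only [displacementPhase, hp, hm, inner_add_left, inner_sub_right, inner_add_right,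
    inner_smul_right, smul_add]
  ring

/-- The probability density of the centered Gaussian random variable on `ℝ²ⁿ` with covariance
matrix `t I`, for `t > 0`. -/
def gaussianDensity (t : ℝ) (x : Phase n) : ℝ :=
  Real.exp (-‖x‖ ^ 2 / (2 * t)) / (2 * Real.pi * t) ^ n

variable [CompleteSpace F]

/-- The state `D_A(x) ρ D_A(x)†`. -/
def displace (x : Phase n) (ρ : Joint n F →L[ℂ] Joint n F) : Joint n F →L[ℂ] Joint n F :=
  displacement x ∘L ρ ∘L ContinuousLinearMap.adjoint (displacement x)

/-- The heat semigroup on `A`, tensored with the identity of `M`: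
`(N_A(t) ⊗ 1)(ρ) = ∫ D_A(x) ρ D_A(x)† p_t(x) dx` for `t > 0`, and the identity for `t = 0`. -/
def heat (t : ℝ) (ρ : Joint n F →L[ℂ] Joint n F) : Joint n F →L[ℂ] Joint n F :=
  if t = 0 then ρ else ∫ x : Phase n, gaussianDensity t x • displace x ρ

/-- The quantum conditional entropy `S(A|M) = S(AM) - S(M)`. -/
def condEntropy (ρ : Joint n F →L[ℂ] Joint n F) : EReal :=
  (entropy ρ : EReal) - (entropy (partialTrace ρ) : EReal)

/-- The state `σ_AMX(t)`, as a density with respect to the Lebesgue measure of `ℝ²ⁿ`: `X` has the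
Gaussian density with variance `t`, and `σ_{AM|X=x} = D_A(x) ρ D_A(x)†`. -/
def gaussianDisplaced (t : ℝ) (ρ : Joint n F →L[ℂ] Joint n F) (x : Phase n) :
    Joint n F →L[ℂ] Joint n F :=
  gaussianDensity t x • displace x ρ

/-- The conditional mutual information `I(A:X|M) = S(A|M) + S(X|M) - S(AX|M)` of a state on `AMX`
with `X` classical, given by its density `ω` (see `cqEntropy`). The marginal on `AM` is
`∫ ω x dx`, the marginal on `M` is `Tr_A ∫ ω x dx`, the marginal on `MX` has density `Tr_A (ω x)`, and
`S(Y|M) = S(YM) - S(M)` for `Y = A, X, AX`. -/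
def condMutualInfo {E : Type*} [MeasureSpace E] (ω : E → (Joint n F →L[ℂ] Joint n F)) : EReal :=
  condEntropy (∫ x, ω x) +
    (cqEntropy (fun x => partialTrace (ω x)) - (entropy (partialTrace (∫ x, ω x)) : EReal)) -
    (cqEntropy ω - (entropy (partialTrace (∫ x, ω x)) : EReal))

/-- The quantum integral conditional Fisher information `Δ_{A|M}(ρ)(t) = I(A:X|M)` for `t > 0`, and
`0` for `t = 0`. -/
def integralFisherInfo (ρ : Joint n F →L[ℂ] Joint n F) (t : ℝ) : EReal :=
  if t = 0 then 0 else condMutualInfo (gaussianDisplaced t ρ)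

end System

end QuantumDeBruijn

end

/-!
With `ω x = p_t(x) D(x) ρ D(x)†`, the marginal of the joint state on `AM` is the output of the heat
semigroup, so the `S(A|M)` term of the conditional mutual information is the first term on the
right-hand side, and it remains to see that `S(X|M) - S(AX|M) = -S(A|M)_ρ`.

For every state `τ` with finite entropy and unitaries `U x`, the identity
`-ps ln (ps) = p (-s ln s) + (-p ln p) s`, applied through the functional calculus of `τ` and
integrated, gives `S = S(τ) + h(p)` for the classical-quantum state with density `p(x) U(x) τ U(x)†`
(`cqEntropy_smul_unitary_conj`). The Gaussian density has finite differential entropy `h(p_t)`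
(`integrable_negMulLog_gaussianDensity`). This applies to `ω`, and to its marginal `p_t(x) ρ_M` on `MX`,
because displacements of `A` do not change the partial trace over `A` (`partialTrace_displace`): its
quadratic form at `u` is the trace of the compression of the operator to `L²(ℝⁿ) ⊗ u`. For the
coefficient of `h(p_t)` to be the same in both cases, the partial trace has to preserve the trace, which
follows from the completeness of the product basis (`prodBasis`).

The entropy `S(M)` of the output cancels once it is finite; it equals `S(ρ_M)`, as the heat semigroup
leaves the marginal on `M` unchanged (`partialTrace_integral_gaussianDisplaced`). This requires the
operator-valued integral to converge: `D` is strongly continuous, and `ρ = S†S` with a Hilbert–Schmidt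
operator `S`, hence `x ↦ D(x) ρ D(x)†` is continuous in operator norm (`continuous_displace`).
-/

noncomputable section

namespace QuantumDeBruijn

/-! ### Traces of positive operators -/

section Trace

variable {H : Type*} [NormedAddCommGroup H] [InnerProductSpace ℂ H] [CompleteSpace H]
  {K : Type*} [NormedAddCommGroup K] [InnerProductSpace ℂ K] [CompleteSpace K]

theorem exists_eq_adjoint_comp_self {T : H →L[ℂ] H} (hT : T.IsPositive) :
    ∃ S : H →L[ℂ] H, T = ContinuousLinearMap.adjoint S ∘L S := by
  obtain ⟨S, hS⟩ := (CStarAlgebra.nonneg_iff_eq_star_mul_self (a := T)).1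
    ((ContinuousLinearMap.nonneg_iff_isPositive T).2 hT)
  exact ⟨S, hS⟩

theorem re_inner_adjoint_comp_self (S : H →L[ℂ] K) (v : H) :
    RCLike.re (inner ℂ v ((ContinuousLinearMap.adjoint S ∘L S) v)) = ‖S v‖ ^ 2 := by
  rw [ContinuousLinearMap.comp_apply, ContinuousLinearMap.adjoint_inner_right,
    inner_self_eq_norm_sq]

theorem trace_adjoint_comp_self {ι : Type*} (b : HilbertBasis ι ℂ H) (S : H →L[ℂ] K) :
    trace (ContinuousLinearMap.adjoint S ∘L S) = ∑' i, ENNReal.ofReal (‖S (b i)‖ ^ 2) := by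
  rw [trace_eq_tsum b (ContinuousLinearMap.isPositive_adjoint_comp_self S)]
  simp only [re_inner_adjoint_comp_self]

theorem trace_add {A B : H →L[ℂ] H} (hA : A.IsPositive) (hB : B.IsPositive) :
    trace (A + B) = trace A + trace B := by
  unfold trace
  rw [← ENNReal.tsum_add]
  refine tsum_congr fun i => ?_
  rw [← ENNReal.ofReal_add (hA.re_inner_nonneg_right _) (hB.re_inner_nonneg_right _),
    add_apply, inner_add_right, map_add]

/-- The scalar is cast to `ℂ`, since the real scalar multiplication of operators on `L²(ℝⁿ; F)` found by
instance search differs from the one of a general Hilbert space. -/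
theorem trace_smul {c : ℝ} (hc : 0 ≤ c) (A : H →L[ℂ] H) :
    trace ((c : ℂ) • A) = ENNReal.ofReal c * trace A := by
  unfold trace
  rw [← ENNReal.tsum_mul_left]
  refine tsum_congr fun i => ?_
  rw [← ENNReal.ofReal_mul hc, smul_apply, inner_smul_right]
  exact congrArg ENNReal.ofReal (Complex.re_ofReal_mul c _)

/-- The trace is invariant under conjugation by an isometry. -/
theorem trace_isometry_conj {U : H →L[ℂ] H} (hU : ∀ v, ‖U v‖ = ‖v‖) {T : H →L[ℂ] H}
    (hT : T.IsPositive) : trace (U ∘L T ∘L ContinuousLinearMap.adjoint U) = trace T := by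
  obtain ⟨S, rfl⟩ := exists_eq_adjoint_comp_self hT
  have e : U ∘L (ContinuousLinearMap.adjoint S ∘L S) ∘L ContinuousLinearMap.adjoint U =
      ContinuousLinearMap.adjoint (S ∘L ContinuousLinearMap.adjoint U) ∘L
        (S ∘L ContinuousLinearMap.adjoint U) := by
    rw [ContinuousLinearMap.adjoint_comp, ContinuousLinearMap.adjoint_adjoint]
    rfl
  rw [e, trace_adjoint_comp_self (basis H), trace_adjoint_comp_self (basis H),
    tsum_norm_sq_adjoint (basis H) (basis H), tsum_norm_sq_adjoint (basis H) (basis H) S]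
  simp only [ContinuousLinearMap.adjoint_comp, ContinuousLinearMap.adjoint_adjoint,
    ContinuousLinearMap.comp_apply, hU]

theorem ofReal_re_inner_le_trace {T : H →L[ℂ] H} (hT : T.IsPositive) {u : H} (hu : ‖u‖ = 1) :
    ENNReal.ofReal (RCLike.re (inner ℂ u (T u))) ≤ trace T := by
  have ho : Orthonormal ℂ ((↑) : ({u} : Set H) → H) := by
    constructor
    · rintro ⟨v, rfl⟩
      exact hu
    · rintro ⟨v, rfl⟩ ⟨w, rfl⟩ h
      exact (h rfl).elim
  obtain ⟨w, b, hw, hb⟩ := ho.exists_hilbertBasis_extension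
  rw [trace_eq_tsum b hT, hb]
  exact ENNReal.le_tsum (f := fun i : w => ENNReal.ofReal (RCLike.re (inner ℂ (i : H) (T i))))
    ⟨u, hw rfl⟩

theorem ofReal_norm_le_trace {T : H →L[ℂ] H} (hT : T.IsPositive) :
    ENNReal.ofReal ‖T‖ ≤ trace T := by
  by_cases htop : trace T = ⊤
  · rw [htop]
    exact le_top
  have h1 : ∀ u : H, ‖u‖ = 1 → RCLike.re (inner ℂ u (T u)) ≤ (trace T).toReal := fun u hu =>
    (ENNReal.ofReal_le_iff_le_toReal htop).1 (ofReal_re_inner_le_trace hT hu)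
  obtain ⟨S, hS⟩ := exists_eq_adjoint_comp_self hT
  have h2 : ∀ u : H, ‖u‖ = 1 → ‖S u‖ ≤ √(trace T).toReal := by
    intro u hu
    refine Real.le_sqrt_of_sq_le ?_
    have := h1 u hu
    rwa [hS, re_inner_adjoint_comp_self, ← hS] at this
  have h3 : ‖S‖ ≤ √(trace T).toReal := by
    refine S.opNorm_le_of_unit_norm (Real.sqrt_nonneg _) ?_
    exact h2
  rw [ENNReal.ofReal_le_iff_le_toReal htop]
  calc ‖T‖ = ‖S‖ * ‖S‖ := by rw [hS, ContinuousLinearMap.norm_adjoint_comp_self]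
    _ ≤ √(trace T).toReal * √(trace T).toReal := by gcongr
    _ = _ := Real.mul_self_sqrt ENNReal.toReal_nonneg

theorem isPositive_cfc {f : ℝ → ℝ} {T : H →L[ℂ] H} (hf : ∀ s ∈ spectrum ℝ T, 0 ≤ f s) :
    (cfc f T).IsPositive :=
  (ContinuousLinearMap.nonneg_iff_isPositive _).1 (cfc_nonneg hf)

/-- Together with `Real.negMulLog_nonneg`, this makes `-τ ln τ` a positive operator. -/
theorem spectrum_subset_Icc {T : H →L[ℂ] H} (hT : T.IsPositive) (h1 : trace T ≤ 1) :
    spectrum ℝ T ⊆ Set.Icc 0 1 := by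
  intro s hs
  have h0 : 0 ≤ T := (ContinuousLinearMap.nonneg_iff_isPositive T).2 hT
  refine ⟨spectrum_nonneg_of_nonneg h0 hs, ?_⟩
  have hn : ‖T‖ ≤ 1 := by
    have := (ofReal_norm_le_trace hT).trans h1
    rwa [ENNReal.ofReal_le_one] at this
  have : Nontrivial (H →L[ℂ] H) := by
    by_contra h
    rw [not_nontrivial_iff_subsingleton] at h
    rw [spectrum.of_subsingleton] at hs
    exact hs
  exact ((le_abs_self s).trans (by simpa using spectrum.norm_le_norm_of_mem hs)).trans hn

theorem eq_of_ofReal_re_inner_eq {G : Type*} [NormedAddCommGroup G] [InnerProductSpace ℂ G]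
    {A B : G →L[ℂ] G} (hA : A.IsPositive) (hB : B.IsPositive)
    (h : ∀ u, ENNReal.ofReal (RCLike.re (inner ℂ u (A u))) =
      ENNReal.ofReal (RCLike.re (inner ℂ u (B u)))) : A = B := by
  rw [← ContinuousLinearMap.coe_inj, ← ext_inner_map]
  intro u
  have h1 : RCLike.re (inner ℂ u (A u)) = RCLike.re (inner ℂ u (B u)) := by
    rw [← ENNReal.ofReal_eq_ofReal_iff (hA.re_inner_nonneg_right u) (hB.re_inner_nonneg_right u)]
    exact h u
  have e : ∀ {C : G →L[ℂ] G}, C.IsPositive →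
      inner ℂ (C u) u = ((RCLike.re (inner ℂ u (C u)) : ℝ) : ℂ) := by
    intro C hC
    rw [hC.inner_left_eq_inner_right u u]
    exact Complex.ext rfl (Complex.nonneg_iff.1 (hC.inner_nonneg_right u)).2.symm
  change inner ℂ (A u) u = inner ℂ (B u) u
  rw [e hA, e hB, h1]

end Trace

/-! ### Entropy of a classical-quantum state -/

section CQ

variable {H : Type*} [NormedAddCommGroup H] [InnerProductSpace ℂ H] [CompleteSpace H]

theorem cfc_unitary_conj {U : H →L[ℂ] H} (hU : U ∈ unitary (H →L[ℂ] H)) {f : ℝ → ℝ}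
    (hf : Continuous f) {T : H →L[ℂ] H} (hT : IsSelfAdjoint T) :
    cfc f (U * T * star U) = U * cfc f T * star U := by
  have h := StarAlgHomClass.map_cfc (S := ℂ) (Unitary.conjStarAlgAut ℂ (H →L[ℂ] H) ⟨U, hU⟩) f T
    hf.continuousOn (by
      change Continuous fun X : H →L[ℂ] H => U * X * star U
      fun_prop) hT (hT.map _)
  simpa only [Unitary.conjStarAlgAut_apply] using h.symm

theorem trace_cfc_smul_unitary_conj {U : H →L[ℂ] H} (hU : U ∈ unitary (H →L[ℂ] H)) {f : ℝ → ℝ}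
    (hf : Continuous f) (hf0 : ∀ s, 0 ≤ f s) {T : H →L[ℂ] H} (hT : T.IsPositive) (c : ℝ) :
    trace (cfc f ((c : ℂ) • (U * T * star U))) = trace (cfc (fun s => f (c * s)) T) := by
  have hsa : IsSelfAdjoint T := hT.isSelfAdjoint
  have hfc : Continuous fun s => f (c * s) := by fun_prop
  have hsa' : IsSelfAdjoint (U * T * star U) := hsa.conjugate U
  rw [Complex.coe_smul, ← cfc_comp_const_mul c f _ hf.continuousOn hsa', cfc_unitary_conj hU hfc hsa]
  exact trace_isometry_conj (ContinuousLinearMap.norm_map_of_mem_unitary hU)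
    (isPositive_cfc fun s _ => hf0 _)

/-- The trace of the identity `-(cs) ln (cs) = c (-s ln s) + (-c ln c) s`, with both sides rearranged
so that only nonnegative terms occur. -/
theorem trace_cfc_negMulLog_mul {τ : H →L[ℂ] H} (hτ : IsState τ) {c : ℝ} (hc : 0 ≤ c) :
    trace (cfc (fun s : ℝ => max (Real.negMulLog (c * s)) 0) τ) +
        ENNReal.ofReal (max (-Real.negMulLog c) 0) =
      trace (cfc (fun s : ℝ => max (-Real.negMulLog (c * s)) 0) τ) +
        (ENNReal.ofReal c * entropy τ + ENNReal.ofReal (max (Real.negMulLog c) 0)) := by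
  have hsp := spectrum_subset_Icc hτ.1 hτ.2.le
  have hsa : IsSelfAdjoint τ := hτ.1.isSelfAdjoint
  have hcont := Real.continuous_negMulLog
  have hpos : ∀ {d : ℝ}, 0 ≤ d → (d • τ).IsPositive := fun hd =>
    (ContinuousLinearMap.nonneg_iff_isPositive _).1
      (smul_nonneg hd ((ContinuousLinearMap.nonneg_iff_isPositive _).2 hτ.1))
  have htr : ∀ {d : ℝ}, 0 ≤ d → ENNReal.ofReal d = trace (d • τ) := fun hd => by
    rw [← Complex.coe_smul, trace_smul hd, hτ.2, mul_one]
  have hent : (cfc Real.negMulLog τ).IsPositive :=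
    isPositive_cfc fun s hs => Real.negMulLog_nonneg (hsp hs).1 (hsp hs).2
  have hent' : (c • cfc Real.negMulLog τ).IsPositive :=
    (ContinuousLinearMap.nonneg_iff_isPositive _).1
      (smul_nonneg hc ((ContinuousLinearMap.nonneg_iff_isPositive _).2 hent))
  have hp := hpos (le_max_right (-Real.negMulLog c) 0)
  have hq := hpos (le_max_right (Real.negMulLog c) 0)
  rw [htr (le_max_right _ _), htr (le_max_right _ _), entropy, ← trace_smul hc, Complex.coe_smul,
    ← trace_add hent' hq, ← trace_add (isPositive_cfc fun s _ => le_max_right _ _) hp,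
    ← trace_add (isPositive_cfc fun s _ => le_max_right _ _) (hent'.add hq)]
  congr 1
  rw [← cfc_const_mul_id (max (-Real.negMulLog c) 0) τ,
    ← cfc_const_mul_id (max (Real.negMulLog c) 0) τ,
    ← cfc_const_mul c Real.negMulLog τ, ← cfc_add .., ← cfc_add .., ← cfc_add ..]
  refine cfc_congr fun s _ => ?_
  -- this cancels all positive and negative parts and leaves the identity for `negMulLog (c * s)`
  have h1 : ∀ a : ℝ, max a 0 = a + max (-a) 0 := fun a => by
    rcases le_total a 0 with h | h
    · rw [max_eq_right h, max_eq_left (neg_nonneg.2 h)]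
      ring
    · rw [max_eq_left h, max_eq_right (neg_nonpos.2 h)]
      ring
  rw [h1 (Real.negMulLog (c * s)), h1 (Real.negMulLog c), Real.negMulLog_mul]
  ring

/-- `S(AX) = S(A) + h(X)` when, conditionally on the classical variable `X`, the state of `A` is
unitarily equivalent to a fixed state `τ`. -/
theorem cqEntropy_smul_unitary_conj {E : Type*} [MeasureSpace E] {f : E → ℝ} (hf : Measurable f)
    (hf0 : ∀ x, 0 ≤ f x) (hf1 : ∫⁻ x, ENNReal.ofReal (f x) = 1)
    (hpos : ∫⁻ x, ENNReal.ofReal (max (Real.negMulLog (f x)) 0) ≠ ⊤)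
    (hneg : ∫⁻ x, ENNReal.ofReal (max (-Real.negMulLog (f x)) 0) ≠ ⊤)
    {τ : H →L[ℂ] H} (hτ : IsState τ) (hent : entropy τ ≠ ⊤) {U : E → (H →L[ℂ] H)}
    (hU : ∀ x, U x ∈ unitary (H →L[ℂ] H)) :
    cqEntropy (fun x => (f x : ℂ) • (U x * τ * star (U x))) =
      (((entropy τ).toReal + ((∫⁻ x, ENNReal.ofReal (max (Real.negMulLog (f x)) 0)).toReal -
        (∫⁻ x, ENNReal.ofReal (max (-Real.negMulLog (f x)) 0)).toReal) : ℝ) : EReal) := by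
  have hg : Measurable fun x => Real.negMulLog (f x) := Real.continuous_negMulLog.measurable.comp hf
  have hmp : Measurable fun x => ENNReal.ofReal (max (Real.negMulLog (f x)) 0) := by fun_prop
  have hmn : Measurable fun x => ENNReal.ofReal (max (-Real.negMulLog (f x)) 0) := by fun_prop
  have hcp : Continuous fun s : ℝ => max (Real.negMulLog s) 0 :=
    Real.continuous_negMulLog.max continuous_const
  have hcn : Continuous fun s : ℝ => max (-Real.negMulLog s) 0 :=
    Real.continuous_negMulLog.neg.max continuous_const
  unfold cqEntropy
  simp only [trace_cfc_smul_unitary_conj (hU _) hcp (fun _ => le_max_right _ _) hτ.1,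
    trace_cfc_smul_unitary_conj (hU _) hcn (fun _ => le_max_right _ _) hτ.1]
  -- splitting the integrals needs measurability of the scalar terms only, not of the traces
  have key : (∫⁻ x, trace (cfc (fun s : ℝ => max (Real.negMulLog (f x * s)) 0) τ)) +
      ∫⁻ x, ENNReal.ofReal (max (-Real.negMulLog (f x)) 0) =
      (∫⁻ x, trace (cfc (fun s : ℝ => max (-Real.negMulLog (f x * s)) 0) τ)) +
        (entropy τ + ∫⁻ x, ENNReal.ofReal (max (Real.negMulLog (f x)) 0)) := by
    rw [← lintegral_add_right _ hmn, lintegral_congr fun x => trace_cfc_negMulLog_mul hτ (hf0 x),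
      lintegral_add_right _ (by fun_prop), lintegral_add_right _ hmp,
      lintegral_mul_const _ (by fun_prop), hf1, one_mul]
  -- the negative part of `-ps ln (ps)` is at most `s` times that of `-p ln p`, as `-s ln s ≥ 0`
  have hB : ∫⁻ x, trace (cfc (fun s : ℝ => max (-Real.negMulLog (f x * s)) 0) τ) ≠ ⊤ := by
    refine ne_top_of_le_ne_top hneg (lintegral_mono fun x => ?_)
    have hsp := spectrum_subset_Icc hτ.1 hτ.2.le
    have hsa : IsSelfAdjoint τ := hτ.1.isSelfAdjoint
    have hle : cfc (fun s : ℝ => max (-Real.negMulLog (f x * s)) 0) τ ≤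
        (max (-Real.negMulLog (f x)) 0) • τ := by
      rw [← cfc_const_mul_id (max (-Real.negMulLog (f x)) 0) τ]
      have := Real.continuous_negMulLog
      refine cfc_mono fun s hs => ?_
      obtain ⟨h0, h1⟩ := hsp hs
      have h2 := mul_nonneg (hf0 x) (Real.negMulLog_nonneg h0 h1)
      refine max_le ?_ (mul_nonneg (le_max_right _ _) h0)
      rw [Real.negMulLog_mul]
      nlinarith [mul_le_mul_of_nonneg_right (le_max_left (-Real.negMulLog (f x)) 0) h0]
    calc _ ≤ trace ((max (-Real.negMulLog (f x)) 0) • τ) := by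
          refine ENNReal.tsum_le_tsum fun i => ENNReal.ofReal_le_ofReal ?_
          have := ((ContinuousLinearMap.le_def _ _).1 hle).re_inner_nonneg_right (basis H i)
          rw [sub_apply, inner_sub_right, map_sub] at this
          linarith
      _ = _ := by rw [← Complex.coe_smul, trace_smul (le_max_right _ _), hτ.2, mul_one]
  have hA : ∫⁻ x, trace (cfc (fun s : ℝ => max (Real.negMulLog (f x * s)) 0) τ) ≠ ⊤ :=
    ne_top_of_le_ne_top
      (ENNReal.add_ne_top.2 ⟨hB, ENNReal.add_ne_top.2 ⟨hent, hpos⟩⟩) (le_self_add.trans key.le)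
  generalize (∫⁻ x, trace (cfc (fun s : ℝ => max (Real.negMulLog (f x * s)) 0) τ)) = a at *
  generalize (∫⁻ x, trace (cfc (fun s : ℝ => max (-Real.negMulLog (f x * s)) 0) τ)) = b at *
  generalize (∫⁻ x, ENNReal.ofReal (max (Real.negMulLog (f x)) 0)) = p at *
  generalize (∫⁻ x, ENNReal.ofReal (max (-Real.negMulLog (f x)) 0)) = m at *
  generalize entropy τ = s at *
  lift a to NNReal using hA
  lift b to NNReal using hB
  lift p to NNReal using hpos
  lift m to NNReal using hneg
  lift s to NNReal using hent
  have key' : (a : ℝ) + m = b + (s + p) := by exact_mod_cast key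
  simp only [ENNReal.coe_toReal]
  have : ((a : ℝ≥0∞) : EReal) - ((b : ℝ≥0∞) : EReal) = (((a : ℝ) - b : ℝ) : EReal) := by
    rw [EReal.coe_sub]; rfl
  rw [this]
  congr 1
  linarith

end CQ

/-! ### Displacement operators -/

section Displacement

open Filter Topology

variable {n : ℕ} {F : Type*} [NormedAddCommGroup F] [InnerProductSpace ℂ F]

theorem displacement_zero : displacement (0 : Phase n) = ContinuousLinearMap.id ℂ (Joint n F) := by
  ext1 ψ
  refine Lp.ext ?_
  filter_upwards [coeFn_displacement 0 ψ] with y hy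
  have hp : posPart (0 : Phase n) = 0 := rfl
  have hm : momPart (0 : Phase n) = 0 := rfl
  rw [hy, displacementPhase, hp, hm]
  simp

theorem displacement_neg_displacement (x : Phase n) (ψ : Joint n F) :
    displacement (-x) (displacement x ψ) = ψ := by
  have hp : posPart (-x) = -posPart x := rfl
  have hm : momPart (-x) = -momPart x := rfl
  rw [displacement_displacement, neg_add_cancel, displacement_zero, hp, hm, inner_neg_left,
    inner_neg_right, sub_self]
  simp

theorem norm_displacement_apply (x : Phase n) (ψ : Joint n F) : ‖displacement x ψ‖ = ‖ψ‖ :=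
  LinearIsometry.norm_map _ ψ

theorem norm_displacement_le (x : Phase n) : ‖(displacement x : Joint n F →L[ℂ] Joint n F)‖ ≤ 1 :=
  LinearIsometry.norm_toContinuousLinearMap_le _

theorem continuous_posPart : Continuous (posPart : Phase n → Config n) := by
  unfold posPart
  fun_prop

theorem continuous_momPart : Continuous (momPart : Phase n → Config n) := by
  unfold momPart
  fun_prop

theorem continuous_translation (ψ : Joint n F) : Continuous fun q : Config n =>
    Lp.compMeasurePreservingₗᵢ ℂ (fun y : Config n => y - q)
      (measurePreserving_sub_right volume q) ψ := by
  let g : Config n → C(Config n, Config n) := fun q => ⟨fun y => y - q, by fun_prop⟩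
  have hg : Continuous g := ContinuousMap.continuous_of_continuous_uncurry g (by
    change Continuous fun p : Config n × Config n => p.2 - p.1
    fun_prop)
  exact (continuous_const (y := ψ)).compMeasurePreservingLp hg
    (fun q => measurePreserving_sub_right volume q) ENNReal.ofNat_ne_top

theorem continuous_phaseMul {X : Type*} [TopologicalSpace X] [FirstCountableTopology X]
    (θ : X → Config n → ℝ) (hθ : ∀ x, Continuous (θ x)) (hθ' : ∀ y, Continuous fun x => θ x y)
    (ψ : Joint n F) : Continuous fun x => phaseMul (θ x) (hθ x) ψ := by
  rw [continuous_iff_continuousAt]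
  intro x₀
  refine (Lp.tendsto_Lp_iff_tendsto_eLpNorm'' _ (fun x => memLp_phase (θ x) (hθ x) ψ) _
    (memLp_phase (θ x₀) (hθ x₀) ψ)).2 ?_
  have h2 : (2 : ℝ≥0∞).toReal = 2 := rfl
  simp only [eLpNorm_eq_lintegral_rpow_enorm_toReal two_ne_zero ENNReal.ofNat_ne_top, h2]
  have hfin : ∫⁻ y, (2 * ‖ψ y‖ₑ) ^ (2 : ℝ) ≠ ⊤ := by
    simp only [ENNReal.mul_rpow_of_nonneg _ _ zero_le_two]
    rw [lintegral_const_mul' _ _ (by simp)]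
    refine ENNReal.mul_ne_top (by simp) ?_
    have := lintegral_rpow_enorm_lt_top_of_eLpNorm_lt_top two_ne_zero ENNReal.ofNat_ne_top
      (Lp.memLp ψ).2
    exact this.ne
  have key : Tendsto (fun x => ∫⁻ y, ‖((fun y => Complex.exp ((θ x y : ℂ) * Complex.I) • ψ y) -
      fun y => Complex.exp ((θ x₀ y : ℂ) * Complex.I) • ψ y) y‖ₑ ^ (2 : ℝ)) (𝓝 x₀)
      (𝓝 (∫⁻ _ : Config n, 0)) := by
    refine tendsto_lintegral_filter_of_dominated_convergence' (fun y => (2 * ‖ψ y‖ₑ) ^ (2 : ℝ))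
      (Eventually.of_forall fun x => ?_) (Eventually.of_forall fun x => ae_of_all _ fun y => ?_)
      hfin (ae_of_all _ fun y => ?_)
    · exact (((memLp_phase (θ x) (hθ x) ψ).sub (memLp_phase (θ x₀) (hθ x₀) ψ)).1.enorm).pow_const _
    · refine ENNReal.rpow_le_rpow ?_ zero_le_two
      refine (enorm_sub_le).trans_eq ?_
      rw [two_mul]
      congr 1 <;> exact enorm_eq_iff_norm_eq.2 (norm_phase_smul _ _ _)
    · have hc : Continuous fun x => ‖((fun y => Complex.exp ((θ x y : ℂ) * Complex.I) • ψ y) -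
          fun y => Complex.exp ((θ x₀ y : ℂ) * Complex.I) • ψ y) y‖ₑ ^ (2 : ℝ) := by
        have := hθ' y
        simp only [Pi.sub_apply]
        refine ENNReal.continuous_rpow_const.comp (Continuous.enorm ?_)
        fun_prop
      have := hc.tendsto x₀
      simpa using this
  rw [lintegral_zero] at key
  have := (ENNReal.continuous_rpow_const (y := 1 / (2 : ℝ))).tendsto 0 |>.comp key
  simpa [Function.comp_def] using this

/-- The displacement operators are strongly continuous. -/
theorem continuous_displacement_apply (ψ : Joint n F) :
    Continuous fun x : Phase n => displacement x ψ := by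
  let τ : Phase n → Joint n F := fun x => Lp.compMeasurePreservingₗᵢ ℂ
    (fun y : Config n => y - posPart x) (measurePreserving_sub_right volume (posPart x)) ψ
  have hτ : Continuous τ := (continuous_translation ψ).comp continuous_posPart
  rw [continuous_iff_continuousAt]
  intro x₀
  let M : Phase n → Joint n F →ₗᵢ[ℂ] Joint n F := fun x =>
    phaseMul (displacementPhase x) (continuous_displacementPhase x)
  have hM : Continuous fun x => M x (τ x₀) := by
    refine continuous_phaseMul displacementPhase continuous_displacementPhase (fun y => ?_) (τ x₀)
    unfold displacementPhase
    have := continuous_posPart (n := n)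
    have := continuous_momPart (n := n)
    fun_prop
  change Tendsto (fun x => M x (τ x)) (𝓝 x₀) (𝓝 (M x₀ (τ x₀)))
  rw [tendsto_iff_norm_sub_tendsto_zero]
  have h1 := tendsto_iff_norm_sub_tendsto_zero.1 (hτ.tendsto x₀)
  have h2 := tendsto_iff_norm_sub_tendsto_zero.1 (hM.tendsto x₀)
  refine squeeze_zero (fun _ => norm_nonneg _) (fun x => ?_) (by simpa using h1.add h2)
  calc ‖M x (τ x) - M x₀ (τ x₀)‖ ≤ ‖M x (τ x) - M x (τ x₀)‖ + ‖M x (τ x₀) - M x₀ (τ x₀)‖ :=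
        norm_sub_le_norm_sub_add_norm_sub _ _ _
    _ = _ := by rw [← map_sub, LinearIsometry.norm_map]

variable [CompleteSpace F]

theorem adjoint_displacement (x : Phase n) :
    ContinuousLinearMap.adjoint (displacement x : Joint n F →L[ℂ] Joint n F) = displacement (-x) := by
  symm
  rw [ContinuousLinearMap.eq_adjoint_iff]
  intro φ ψ
  rw [← (LinearMap.norm_map_iff_inner_map_map (displacement x : Joint n F →L[ℂ] Joint n F)).1
    (norm_displacement_apply x) (displacement (-x) φ) ψ]
  have h := displacement_neg_displacement (-x) φ
  rw [neg_neg] at h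
  rw [h]

theorem displacement_mem_unitary (x : Phase n) :
    displacement x ∈ unitary (Joint n F →L[ℂ] Joint n F) := by
  rw [Unitary.mem_iff, ContinuousLinearMap.star_eq_adjoint, adjoint_displacement]
  constructor
  · ext1 ψ
    exact displacement_neg_displacement x ψ
  · ext1 ψ
    have := displacement_neg_displacement (-x) ψ
    rwa [neg_neg] at this

theorem displace_eq_conj (x : Phase n) (ρ : Joint n F →L[ℂ] Joint n F) :
    displace x ρ =
    displacement x * ρ * star (displacement x : Joint n F →L[ℂ] Joint n F) := rfl

end Displacement

/-! ### Hilbert–Schmidt operators -/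

section TraceClass

variable {H : Type*} [NormedAddCommGroup H] [InnerProductSpace ℂ H] [CompleteSpace H]

open InnerProductSpace in
theorem norm_sum_rankOne_le {H : Type*} [NormedAddCommGroup H] [InnerProductSpace ℂ H]
    {K : Type*} [NormedAddCommGroup K] [InnerProductSpace ℂ K] {ι : Type*} {b : ι → H} (hb : Orthonormal ℂ b) (w : ι → K)
    (s : Finset ι) : ‖∑ j ∈ s, rankOne ℂ (w j) (b j)‖ ≤ √(∑ j ∈ s, ‖w j‖ ^ 2) := by
  refine ContinuousLinearMap.opNorm_le_bound _ (Real.sqrt_nonneg _) fun v => ?_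
  rw [sum_apply]
  calc ‖∑ j ∈ s, rankOne ℂ (w j) (b j) v‖ ≤ ∑ j ∈ s, ‖w j‖ * ‖inner ℂ (b j) v‖ := by
        refine (norm_sum_le _ _).trans_eq (Finset.sum_congr rfl fun j _ => ?_)
        rw [rankOne_apply, norm_smul, mul_comm]
    _ ≤ √(∑ j ∈ s, ‖w j‖ ^ 2) * √(∑ j ∈ s, ‖inner ℂ (b j) v‖ ^ 2) :=
        Real.sum_mul_le_sqrt_mul_sqrt s _ _
    _ ≤ √(∑ j ∈ s, ‖w j‖ ^ 2) * ‖v‖ := by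
        gcongr
        exact Real.sqrt_le_iff.2 ⟨norm_nonneg _, hb.sum_inner_products_le v⟩

open InnerProductSpace in
/-- A Hilbert–Schmidt operator is the sum of its matrix columns in operator norm. -/
theorem hasSum_rankOne {H : Type*} [NormedAddCommGroup H] [InnerProductSpace ℂ H]
    {K : Type*} [NormedAddCommGroup K] [InnerProductSpace ℂ K] [CompleteSpace K] {ι : Type*} (b : HilbertBasis ι ℂ H) (S : H →L[ℂ] K)
    (hS : Summable fun j => ‖S (b j)‖ ^ 2) :
    HasSum (fun j => rankOne ℂ (S (b j)) (b j)) S := by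
  have hsum : Summable fun j => rankOne ℂ (S (b j)) (b j) := by
    rw [summable_iff_vanishing_norm]
    intro ε hε
    obtain ⟨s, hs⟩ := summable_iff_vanishing_norm.1 hS (ε ^ 2) (by positivity)
    refine ⟨s, fun t ht => (norm_sum_rankOne_le b.orthonormal _ t).trans_lt ?_⟩
    rw [Real.sqrt_lt' hε]
    exact (le_abs_self _).trans_lt (hs t ht)
  convert hsum.hasSum using 1
  ext1 v
  have h1 := (ContinuousLinearMap.apply ℂ K v).hasSum hsum.hasSum
  have h2 := S.hasSum (b.hasSum_repr v)
  refine (h2.unique ?_)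
  have e : ∀ j, S (b.repr v j • b j) =
      ContinuousLinearMap.apply ℂ K v (rankOne ℂ (S (b j)) (b j)) := fun j => by
    simp [b.repr_apply_apply]
  simp only [e]
  exact h1

/-- If `U` is strongly continuous and contractive and `S` is a Hilbert–Schmidt operator, then `U x S` is
continuous in operator norm. -/
theorem continuous_comp_of_summable {X : Type*} [TopologicalSpace X] {U : X → (H →L[ℂ] H)}
    (hU : ∀ x, ‖U x‖ ≤ 1) (hc : ∀ v, Continuous fun x => U x v) {ι : Type*}
    (b : HilbertBasis ι ℂ H) (S : H →L[ℂ] H) (hS : Summable fun j => ‖S (b j)‖ ^ 2) :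
    Continuous fun x => U x ∘L S := by
  have h := hasSum_rankOne b S hS
  refine TendstoUniformly.continuous
    (F := fun (s : Finset ι) x => U x ∘L ∑ j ∈ s, InnerProductSpace.rankOne ℂ (S (b j)) (b j))
    (p := Filter.atTop) ?_ (Filter.Frequently.of_forall fun s => ?_)
  · rw [Metric.tendstoUniformly_iff]
    intro ε hε
    filter_upwards [(Metric.tendsto_nhds.1 h) ε hε] with s hs x
    rw [dist_comm, dist_eq_norm] at *
    rw [← ContinuousLinearMap.comp_sub]
    rw [norm_sub_rev] at hs
    refine lt_of_le_of_lt ?_ hs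
    refine (ContinuousLinearMap.opNorm_comp_le _ _).trans ?_
    rw [norm_sub_rev]
    exact mul_le_of_le_one_left (norm_nonneg _) (hU x)
  · simp only [ContinuousLinearMap.comp_finsetSum, InnerProductSpace.comp_rankOne]
    refine continuous_finsetSum _ fun j _ => ?_
    have := hc (S (b j))
    fun_prop

end TraceClass

/-! ### The product basis and the partial trace -/

section PartialTrace

variable {n : ℕ} {F : Type*} [NormedAddCommGroup F] [InnerProductSpace ℂ F]

/-- The product vector `e ⊗ u`, as a linear function of `e` (`tensorLeft` is the linear function of
`u`). -/
def tensorRight (u : F) : Joint n ℂ →L[ℂ] Joint n F :=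
  (ContinuousLinearMap.toSpanSingleton ℂ u).compLpL 2 volume

theorem tensorRight_apply (u : F) (e : Joint n ℂ) : tensorRight u e = tensorLeft e u := rfl

theorem inner_tensorLeft (e e' : Joint n ℂ) (u u' : F) :
    inner ℂ (tensorLeft e u) (tensorLeft e' u') = inner ℂ e e' * inner ℂ u u' := by
  rw [L2.inner_def, L2.inner_def, ← integral_mul_const]
  refine integral_congr_ae ?_
  filter_upwards [coeFn_tensorLeft e u, coeFn_tensorLeft e' u'] with y h1 h2
  rw [h1, h2, inner_smul_left, inner_smul_right, RCLike.inner_apply]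
  ring

variable [CompleteSpace F]

/-- The product basis `e_i ⊗ f_j` of `L²(ℝⁿ) ⊗ F`. -/
def prodBasis {ι κ : Type*} (b : HilbertBasis ι ℂ (Joint n ℂ)) (c : HilbertBasis κ ℂ F) :
    HilbertBasis (ι × κ) ℂ (Joint n F) :=
  HilbertBasis.mk (v := fun p : ι × κ => tensorLeft (b p.1) (c p.2)) (by
    classical
    rw [orthonormal_iff_ite]
    rintro ⟨i, j⟩ ⟨i', j'⟩
    rw [inner_tensorLeft, orthonormal_iff_ite.1 b.orthonormal, orthonormal_iff_ite.1 c.orthonormal]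
    by_cases hi : i = i' <;> by_cases hj : j = j' <;> simp [hi, hj]) (by
    set N := (Submodule.span ℂ
      (Set.range fun p : ι × κ => (tensorLeft (b p.1) (c p.2) : Joint n F))).topologicalClosure
      with hN
    have hNc : IsClosed (N : Set (Joint n F)) := Submodule.isClosed_topologicalClosure _
    -- the closed span contains all product vectors, in particular the `F`-valued indicator functions
    have h1 : ∀ (j : κ) (e : Joint n ℂ), tensorLeft e (c j) ∈ N := by
      intro j e
      have hle : (Submodule.span ℂ (Set.range b)).topologicalClosure ≤
          N.comap (tensorRight (c j) : Joint n ℂ →L[ℂ] Joint n F).toLinearMap := by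
        refine Submodule.topologicalClosure_minimal _ (Submodule.span_le.2 ?_)
          (hNc.preimage (tensorRight (c j)).continuous)
        rintro _ ⟨i, rfl⟩
        exact Submodule.le_topologicalClosure _ (Submodule.subset_span ⟨(i, j), rfl⟩)
      rw [b.dense_span] at hle
      exact hle (Submodule.mem_top (x := e))
    have h2 : ∀ (e : Joint n ℂ) (u : F), tensorLeft e u ∈ N := by
      intro e u
      have hle : (Submodule.span ℂ (Set.range c)).topologicalClosure ≤
          N.comap (tensorLeft e : F →L[ℂ] Joint n F).toLinearMap := by
        refine Submodule.topologicalClosure_minimal _ (Submodule.span_le.2 ?_)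
          (hNc.preimage (tensorLeft e).continuous)
        rintro _ ⟨j, rfl⟩
        exact h1 j e
      rw [c.dense_span] at hle
      exact hle (Submodule.mem_top (x := u))
    intro ψ _
    refine Lp.induction ENNReal.ofNat_ne_top (fun ψ => ψ ∈ N) (fun u s hs hμs => ?_)
      (fun f g hf hg _ h h' => N.add_mem h h') hNc ψ
    convert h2 (indicatorConstLp 2 hs hμs.ne 1) u using 1
    refine Lp.ext ?_
    rw [Lp.simpleFunc.coe_indicatorConst]
    filter_upwards [coeFn_tensorLeft (indicatorConstLp 2 hs hμs.ne (1 : ℂ)) u,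
      indicatorConstLp_coeFn (p := 2) (hs := hs) (hμs := hμs.ne) (c := u),
      indicatorConstLp_coeFn (p := 2) (hs := hs) (hμs := hμs.ne) (c := (1 : ℂ))] with y a1 a2 a3
    rw [a1, a2, a3]
    by_cases hy : y ∈ s <;> simp [hy])

theorem prodBasis_apply {ι κ : Type*} (b : HilbertBasis ι ℂ (Joint n ℂ)) (c : HilbertBasis κ ℂ F)
    (i : ι) (j : κ) : prodBasis b c (i, j) = tensorLeft (b i) (c j) := by
  rw [prodBasis, HilbertBasis.coe_mk]

theorem isPositive_partialTrace {T : Joint n F →L[ℂ] Joint n F} (hT : T.IsPositive) :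
    (partialTrace T).IsPositive := by
  rw [← ContinuousLinearMap.nonneg_iff_isPositive]
  exact tsum_nonneg fun i =>
    (ContinuousLinearMap.nonneg_iff_isPositive _).2 (hT.adjoint_conj _)

theorem re_inner_adjoint_conj {H K : Type*} [NormedAddCommGroup H] [InnerProductSpace ℂ H]
    [CompleteSpace H] [NormedAddCommGroup K] [InnerProductSpace ℂ K] [CompleteSpace K]
    (T : K →L[ℂ] K) (V : H →L[ℂ] K) (u : H) :
    RCLike.re (inner ℂ u ((ContinuousLinearMap.adjoint V ∘L T ∘L V) u)) =
      RCLike.re (inner ℂ (V u) (T (V u))) := by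
  rw [ContinuousLinearMap.comp_apply, ContinuousLinearMap.adjoint_inner_right]
  rfl

theorem tsum_trace_slice {ι : Type*} (b : HilbertBasis ι ℂ (Joint n ℂ))
    {T : Joint n F →L[ℂ] Joint n F} (hT : T.IsPositive) :
    ∑' i, trace (ContinuousLinearMap.adjoint (tensorLeft (F := F) (b i)) ∘L T ∘L
      tensorLeft (b i)) = trace T := by
  rw [trace_eq_tsum (prodBasis b (basis F)) hT, ENNReal.tsum_prod']
  refine tsum_congr fun i => ?_
  unfold trace
  simp only [re_inner_adjoint_conj, prodBasis_apply]

/-- The series of the partial trace of a positive trace class operator converges in norm. -/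
theorem hasSum_partialTrace {T : Joint n F →L[ℂ] Joint n F} (hT : T.IsPositive)
    (htr : trace T ≠ ⊤) :
    HasSum (fun i => ContinuousLinearMap.adjoint (tensorLeft (F := F) (basis (Joint n ℂ) i)) ∘L T ∘L
      tensorLeft (basis (Joint n ℂ) i)) (partialTrace T) := by
  refine Summable.hasSum (Summable.of_norm ?_)
  have h : ∑' i, ENNReal.ofReal ‖ContinuousLinearMap.adjoint
      (tensorLeft (F := F) (basis (Joint n ℂ) i)) ∘L T ∘L tensorLeft (basis (Joint n ℂ) i)‖ ≠ ⊤ := by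
    refine ne_top_of_le_ne_top htr ?_
    rw [← tsum_trace_slice (basis (Joint n ℂ)) hT]
    exact ENNReal.tsum_le_tsum fun i => ofReal_norm_le_trace (hT.adjoint_conj _)
  have h' := ENNReal.summable_toReal h
  simpa only [ENNReal.toReal_ofReal (norm_nonneg _)] using h'

theorem ofReal_re_inner_partialTrace_eq_tsum {T : Joint n F →L[ℂ] Joint n F} (hT : T.IsPositive)
    (htr : trace T ≠ ⊤) (u : F) :
    ENNReal.ofReal (RCLike.re (inner ℂ u (partialTrace T u))) =
      ∑' i, ENNReal.ofReal (RCLike.re (inner ℂ (tensorLeft (basis (Joint n ℂ) i) u)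
        (T (tensorLeft (basis (Joint n ℂ) i) u)))) := by
  have h := (RCLike.reCLM (K := ℂ)).hasSum ((innerSL ℂ u).hasSum
    ((ContinuousLinearMap.apply ℂ F u).hasSum (hasSum_partialTrace hT htr)))
  have h' : HasSum (fun i => RCLike.re (inner ℂ (tensorLeft (basis (Joint n ℂ) i) u)
      (T (tensorLeft (basis (Joint n ℂ) i) u)))) (RCLike.re (inner ℂ u (partialTrace T u))) := by
    refine HasSum.congr_fun h ?_
    intro i
    exact (re_inner_adjoint_conj T _ u).symm
  rw [← h'.tsum_eq, ENNReal.ofReal_tsum_of_nonneg (fun i => hT.re_inner_nonneg_right _) h'.summable]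

/-- The quadratic form of the partial trace at `u` is the trace over `A` of the compression of `T` to
`L²(ℝⁿ) ⊗ u`. In this form it does not depend on the basis of `L²(ℝⁿ)`. -/
theorem ofReal_re_inner_partialTrace {T : Joint n F →L[ℂ] Joint n F} (hT : T.IsPositive)
    (htr : trace T ≠ ⊤) (u : F) :
    ENNReal.ofReal (RCLike.re (inner ℂ u (partialTrace T u))) =
      trace (ContinuousLinearMap.adjoint (tensorRight (n := n) u) ∘L T ∘L tensorRight u) := by
  rw [ofReal_re_inner_partialTrace_eq_tsum hT htr]
  unfold trace
  simp only [re_inner_adjoint_conj, tensorRight_apply]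

theorem trace_partialTrace {T : Joint n F →L[ℂ] Joint n F} (hT : T.IsPositive)
    (htr : trace T ≠ ⊤) : trace (partialTrace T) = trace T := by
  rw [← tsum_trace_slice (basis (Joint n ℂ)) hT]
  unfold trace
  simp only [ofReal_re_inner_partialTrace_eq_tsum hT htr, re_inner_adjoint_conj]
  exact ENNReal.tsum_comm

theorem partialTrace_smul {T : Joint n F →L[ℂ] Joint n F} (c : ℂ) :
    partialTrace (c • T) = c • partialTrace T := by
  unfold partialTrace
  rw [← tsum_const_smul'']
  refine tsum_congr fun i => ?_
  rw [ContinuousLinearMap.smul_comp, ContinuousLinearMap.comp_smul]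

theorem isPositive_displace (x : Phase n) {T : Joint n F →L[ℂ] Joint n F} (hT : T.IsPositive) :
    (displace x T).IsPositive := by
  unfold displace
  exact hT.conj_adjoint (displacement x)

theorem trace_displace (x : Phase n) {T : Joint n F →L[ℂ] Joint n F} (hT : T.IsPositive) :
    trace (displace x T) = trace T := by
  unfold displace
  exact trace_isometry_conj
    (ContinuousLinearMap.norm_map_of_mem_unitary (displacement_mem_unitary x)) hT

/-- A displacement acts on the compression to `L²(ℝⁿ) ⊗ u` as a displacement of `L²(ℝⁿ)`. -/
theorem trace_slice_displace (x : Phase n) {T : Joint n F →L[ℂ] Joint n F} (hT : T.IsPositive)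
    (u : F) :
    trace (ContinuousLinearMap.adjoint (tensorRight (n := n) u) ∘L displace x T ∘L tensorRight u) =
      trace (ContinuousLinearMap.adjoint (tensorRight (n := n) u) ∘L T ∘L tensorRight u) := by
  have hcomm : ∀ z : Phase n, displacement z ∘L tensorRight (n := n) u =
      tensorRight u ∘L displacement z := fun z => by
    ext1 e
    exact displacement_tensorLeft z e u
  have h1 := congrArg ContinuousLinearMap.adjoint (hcomm (-x))
  rw [ContinuousLinearMap.adjoint_comp, ContinuousLinearMap.adjoint_comp, adjoint_displacement,
    adjoint_displacement, neg_neg] at h1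
  rw [← trace_isometry_conj
    (ContinuousLinearMap.norm_map_of_mem_unitary (displacement_mem_unitary x))
    (hT.adjoint_conj (tensorRight (n := n) u))]
  congr 1
  calc _ = (ContinuousLinearMap.adjoint (tensorRight (n := n) u) ∘L displacement x) ∘L T ∘L
        (displacement (-x) ∘L tensorRight u) := by
        rw [displace, adjoint_displacement]
        rfl
    _ = _ := by
        rw [h1, hcomm, adjoint_displacement]
        rfl

theorem partialTrace_displace (x : Phase n) {T : Joint n F →L[ℂ] Joint n F} (hT : T.IsPositive)
    (htr : trace T ≠ ⊤) : partialTrace (displace x T) = partialTrace T := by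
  refine eq_of_ofReal_re_inner_eq (isPositive_partialTrace (isPositive_displace x hT))
    (isPositive_partialTrace hT) fun u => ?_
  rw [ofReal_re_inner_partialTrace (isPositive_displace x hT) (by rwa [trace_displace x hT]),
    ofReal_re_inner_partialTrace hT htr, trace_slice_displace x hT]

end PartialTrace

/-! ### Integrals of positive operators -/

section Integral

/- The real structure of `H` is a parameter: on `L²(ℝⁿ; F)` the one found by instance search is
inherited from `F`, and agrees only up to unfolding with the restriction of the complex one. -/
variable {H : Type*} [NormedAddCommGroup H] [InnerProductSpace ℂ H] [CompleteSpace H]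
  [NormedSpace ℝ H] [IsScalarTower ℝ ℂ H]
  {K : Type*} [NormedAddCommGroup K] [InnerProductSpace ℂ K] [CompleteSpace K]
  {E : Type*} [MeasurableSpace E] {μ : Measure E} {ω : E → (H →L[ℂ] H)}

theorem inner_integral_apply (hω : Integrable ω μ) (v : H) :
    Integrable (fun x => inner ℂ v (ω x v)) μ ∧
      inner ℂ v ((∫ x, ω x ∂μ) v) = ∫ x, inner ℂ v (ω x v) ∂μ := by
  let L : (H →L[ℂ] H) →L[ℝ] ℂ :=
    (innerSL ℂ v ∘L ContinuousLinearMap.apply ℂ H v).restrictScalars ℝ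
  exact ⟨L.integrable_comp hω, (L.integral_comp_comm hω).symm⟩

/-- The quadratic form of the integral is the integral of the quadratic forms, which are real. -/
theorem inner_integral_apply_eq_ofReal (hω : Integrable ω μ) (hpos : ∀ x, (ω x).IsPositive)
    (v : H) : inner ℂ v ((∫ x, ω x ∂μ) v) =
      ((∫ x, RCLike.re (inner ℂ v (ω x v)) ∂μ : ℝ) : ℂ) := by
  rw [(inner_integral_apply hω v).2, ← integral_complex_ofReal]
  refine integral_congr_ae (Filter.Eventually.of_forall fun x => ?_)
  exact Complex.ext rfl (Complex.nonneg_iff.1 ((hpos x).inner_nonneg_right v)).2.symm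

theorem isPositive_integral (hω : Integrable ω μ) (hpos : ∀ x, (ω x).IsPositive) :
    (∫ x, ω x ∂μ).IsPositive := by
  rw [ContinuousLinearMap.isPositive_iff_complex]
  intro v
  have h := inner_integral_apply_eq_ofReal hω hpos v
  have h' : inner ℂ ((∫ x, ω x ∂μ) v) v =
      ((∫ x, RCLike.re (inner ℂ v (ω x v)) ∂μ : ℝ) : ℂ) := by
    rw [← inner_conj_symm, h, Complex.conj_ofReal]
  rw [h']
  exact ⟨rfl, integral_nonneg fun x => (hpos x).re_inner_nonneg_right v⟩

theorem ofReal_re_inner_integral (hω : Integrable ω μ) (hpos : ∀ x, (ω x).IsPositive) (v : H) :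
    ENNReal.ofReal (RCLike.re (inner ℂ v ((∫ x, ω x ∂μ) v))) =
      ∫⁻ x, ENNReal.ofReal (RCLike.re (inner ℂ v (ω x v))) ∂μ := by
  rw [inner_integral_apply_eq_ofReal hω hpos, ← ofReal_integral_eq_lintegral_ofReal
    (inner_integral_apply hω v).1.re
    (Filter.Eventually.of_forall fun x => (hpos x).re_inner_nonneg_right v)]
  rfl

theorem aemeasurable_re_inner (hω : Integrable ω μ) (v : H) :
    AEMeasurable (fun x => ENNReal.ofReal (RCLike.re (inner ℂ v (ω x v)))) μ :=
  (inner_integral_apply hω v).1.re.1.aemeasurable.ennreal_ofReal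

theorem trace_integral_le (hω : Integrable ω μ) (hpos : ∀ x, (ω x).IsPositive) :
    trace (∫ x, ω x ∂μ) ≤ ∫⁻ x, trace (ω x) ∂μ := by
  unfold trace
  simp only [ofReal_re_inner_integral hω hpos]
  -- the basis may be uncountable, so the sum is exchanged with the integral on finite subsets only
  rw [ENNReal.tsum_eq_iSup_sum]
  refine iSup_le fun s => ?_
  rw [← lintegral_finsetSum' s fun i _ => aemeasurable_re_inner hω _]
  exact lintegral_mono fun x => ENNReal.sum_le_tsum s

theorem countable_of_hilbertBasis {H : Type*} [NormedAddCommGroup H]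
    [InnerProductSpace ℂ H] [TopologicalSpace.SeparableSpace H] {ι : Type*}
    (b : HilbertBasis ι ℂ H) : Countable ι := by
  -- distinct basis vectors have distance `√2`, so balls of radius `1/2` around them are disjoint
  have h : (Set.univ : Set ι).PairwiseDisjoint fun i => Metric.ball (b i) 2⁻¹ := by
    intro i _ j _ hij
    refine Metric.ball_disjoint_ball ?_
    have hs : ‖b i - b j‖ ^ 2 = 2 := by
      rw [@norm_sub_sq ℂ, b.orthonormal.1 i, b.orthonormal.1 j, b.orthonormal.2 hij]
      norm_num
    rw [dist_eq_norm]
    nlinarith [norm_nonneg (b i - b j)]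
  rw [← Set.countable_univ_iff]
  exact h.countable_of_isOpen (fun i _ => Metric.isOpen_ball)
    fun i _ => Metric.nonempty_ball.2 (by norm_num)

theorem trace_adjoint_conj_integral [TopologicalSpace.SeparableSpace K] (hω : Integrable ω μ)
    (hpos : ∀ x, (ω x).IsPositive) (W : K →L[ℂ] H) :
    trace (ContinuousLinearMap.adjoint W ∘L (∫ x, ω x ∂μ) ∘L W) =
      ∫⁻ x, trace (ContinuousLinearMap.adjoint W ∘L ω x ∘L W) ∂μ := by
  have := countable_of_hilbertBasis (basis K)
  unfold trace
  simp only [re_inner_adjoint_conj, ofReal_re_inner_integral hω hpos]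
  exact (lintegral_tsum fun i => aemeasurable_re_inner hω _).symm

end Integral

/-! ### The Gaussian density -/

section Gaussian

variable {n : ℕ} {t : ℝ}

theorem gaussianDensity_nonneg (ht : 0 < t) (x : Phase n) : 0 ≤ gaussianDensity t x := by
  unfold gaussianDensity
  positivity

theorem continuous_gaussianDensity : Continuous (gaussianDensity t : Phase n → ℝ) := by
  unfold gaussianDensity
  fun_prop

theorem integral_exp_neg_mul_norm_sq {b : ℝ} (hb : 0 < b) :
    ∫ x : Phase n, Real.exp (-b * ‖x‖ ^ 2) = (Real.pi / b) ^ n := by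
  rw [GaussianFourier.integral_rexp_neg_mul_sq_norm hb, finrank_euclideanSpace,
    Fintype.card_prod, Fintype.card_fin, Fintype.card_fin, ← Real.rpow_natCast]
  congr 1
  push_cast
  ring

theorem integrable_exp_neg_mul_norm_sq {b : ℝ} (hb : 0 < b) :
    Integrable fun x : Phase n => Real.exp (-b * ‖x‖ ^ 2) := by
  refine Integrable.of_integral_ne_zero ?_
  rw [integral_exp_neg_mul_norm_sq hb]
  positivity

theorem gaussianDensity_eq (x : Phase n) :
    gaussianDensity t x = Real.exp (-(2 * t)⁻¹ * ‖x‖ ^ 2) / (2 * Real.pi * t) ^ n := by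
  unfold gaussianDensity
  congr 2
  rw [div_eq_mul_inv]
  ring

theorem integrable_gaussianDensity (ht : 0 < t) :
    Integrable (gaussianDensity t : Phase n → ℝ) := by
  simp only [funext gaussianDensity_eq]
  exact (integrable_exp_neg_mul_norm_sq (by positivity)).div_const _

theorem integral_gaussianDensity (ht : 0 < t) : ∫ x : Phase n, gaussianDensity t x = 1 := by
  simp only [gaussianDensity_eq]
  rw [integral_div, integral_exp_neg_mul_norm_sq (by positivity), div_inv_eq_mul,
    show Real.pi * (2 * t) = 2 * Real.pi * t by ring, div_self (by positivity)]

theorem lintegral_gaussianDensity (ht : 0 < t) :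
    ∫⁻ x : Phase n, ENNReal.ofReal (gaussianDensity t x) = 1 := by
  rw [← ofReal_integral_eq_lintegral_ofReal (integrable_gaussianDensity ht)
    (Filter.Eventually.of_forall fun x => gaussianDensity_nonneg ht x),
    integral_gaussianDensity ht, ENNReal.ofReal_one]

/-- The Gaussian random variable has finite differential entropy. -/
theorem integrable_negMulLog_gaussianDensity (ht : 0 < t) :
    Integrable fun x : Phase n => Real.negMulLog (gaussianDensity t x) := by
  set Z : ℝ := (2 * Real.pi * t) ^ n with hZ
  have hZ0 : 0 < Z := by positivity
  have hmaj : Integrable fun x : Phase n => (2 * Real.exp (-(4 * t)⁻¹ * ‖x‖ ^ 2) +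
      |Real.log Z| * Real.exp (-(2 * t)⁻¹ * ‖x‖ ^ 2)) / Z :=
    (((integrable_exp_neg_mul_norm_sq (by positivity)).const_mul 2).add
      ((integrable_exp_neg_mul_norm_sq (by positivity)).const_mul _)).div_const Z
  refine hmaj.mono' (Real.continuous_negMulLog.comp
    continuous_gaussianDensity).aestronglyMeasurable (Filter.Eventually.of_forall fun x => ?_)
  rw [gaussianDensity_eq, ← hZ, Real.negMulLog, Real.log_div (Real.exp_ne_zero _) hZ0.ne',
    Real.log_exp]
  set u : ℝ := (4 * t)⁻¹ * ‖x‖ ^ 2 with hu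
  have hu0 : 0 ≤ u := by positivity
  have e1 : -(2 * t)⁻¹ * ‖x‖ ^ 2 = -(2 * u) := by
    rw [hu]
    field_simp
    ring
  have e2 : -(4 * t)⁻¹ * ‖x‖ ^ 2 = -u := by rw [hu, neg_mul]
  rw [e1, e2]
  -- the quadratic factor is absorbed by half of the exponent: `u exp(-2u) ≤ exp(-u)`
  have h1 : u * Real.exp (-(2 * u)) ≤ Real.exp (-u) := by
    have : Real.exp (-(2 * u)) = Real.exp (-u) * Real.exp (-u) := by
      rw [← Real.exp_add]
      ring_nf
    rw [this, ← mul_assoc]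
    refine mul_le_of_le_one_left (Real.exp_pos _).le ?_
    rw [Real.exp_neg, ← div_eq_mul_inv, div_le_one (Real.exp_pos _)]
    linarith [Real.add_one_le_exp u]
  have e3 : -(Real.exp (-(2 * u)) / Z) * (-(2 * u) - Real.log Z) =
      (2 * (u * Real.exp (-(2 * u))) + Real.log Z * Real.exp (-(2 * u))) / Z := by ring
  rw [e3, Real.norm_eq_abs, abs_div, abs_of_pos hZ0]
  gcongr
  refine (abs_add_le _ _).trans ?_
  rw [abs_of_nonneg (by positivity), abs_mul, Real.abs_exp]
  gcongr

end Gaussian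

/-! ### The heat semigroup -/

section Heat

variable {n : ℕ} {F : Type*} [NormedAddCommGroup F] [InnerProductSpace ℂ F] [CompleteSpace F]
  {ρ : Joint n F →L[ℂ] Joint n F} {t : ℝ}

/-- For a trace class operator `ρ` the displaced operators depend continuously on the displacement,
in operator norm. -/
theorem continuous_displace (hρ : ρ.IsPositive) (htr : trace ρ ≠ ⊤) :
    Continuous fun x : Phase n => displace x ρ := by
  obtain ⟨S, rfl⟩ := exists_eq_adjoint_comp_self hρ
  have hsum : Summable fun j => ‖ContinuousLinearMap.adjoint S (basis (Joint n F) j)‖ ^ 2 := by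
    rw [trace_adjoint_comp_self (basis _), tsum_norm_sq_adjoint (basis _) (basis _)] at htr
    simpa only [ENNReal.toReal_ofReal (sq_nonneg _)] using ENNReal.summable_toReal htr
  have hc := continuous_comp_of_summable (U := fun x : Phase n => displacement (F := F) x)
    norm_displacement_le continuous_displacement_apply (basis (Joint n F)) _ hsum
  have e : ∀ x : Phase n, displace x (ContinuousLinearMap.adjoint S ∘L S) =
      (displacement x ∘L ContinuousLinearMap.adjoint S) ∘L
        ContinuousLinearMap.adjoint (displacement x ∘L ContinuousLinearMap.adjoint S) := fun x => by
    rw [ContinuousLinearMap.adjoint_comp, ContinuousLinearMap.adjoint_adjoint]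
    rfl
  simp only [e]
  exact hc.clm_comp (ContinuousLinearMap.adjoint.continuous.comp hc)

theorem norm_displace_le (x : Phase n) (ρ : Joint n F →L[ℂ] Joint n F) :
    ‖displace x ρ‖ ≤ ‖ρ‖ := by
  have h := norm_displacement_le (F := F) x
  have h' : ‖ContinuousLinearMap.adjoint (displacement (F := F) x)‖ ≤ 1 := by
    rwa [LinearIsometryEquiv.norm_map]
  calc ‖displace x ρ‖ ≤ ‖displacement (F := F) x‖ *
        (‖ρ‖ * ‖ContinuousLinearMap.adjoint (displacement (F := F) x)‖) :=
        (ContinuousLinearMap.opNorm_comp_le _ _).trans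
          (mul_le_mul_of_nonneg_left (ContinuousLinearMap.opNorm_comp_le _ _) (norm_nonneg _))
    _ ≤ 1 * (‖ρ‖ * 1) := by gcongr
    _ = ‖ρ‖ := by ring

theorem gaussianDisplaced_eq_smul (t : ℝ) (ρ : Joint n F →L[ℂ] Joint n F) (x : Phase n) :
    gaussianDisplaced t ρ x = (gaussianDensity t x : ℂ) • displace x ρ := by
  rw [gaussianDisplaced]
  exact (algebraMap_smul ℂ (gaussianDensity t x) (displace x ρ)).symm

theorem isPositive_gaussianDisplaced (ht : 0 < t) (hρ : ρ.IsPositive) (x : Phase n) :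
    (gaussianDisplaced t ρ x).IsPositive := by
  rw [gaussianDisplaced_eq_smul]
  exact (isPositive_displace x hρ).smul_of_nonneg
    (Complex.zero_le_real.2 (gaussianDensity_nonneg ht x))

theorem integrable_gaussianDisplaced (ht : 0 < t) (hρ : ρ.IsPositive) (htr : trace ρ ≠ ⊤) :
    Integrable (gaussianDisplaced t ρ) := by
  rw [funext (gaussianDisplaced_eq_smul t ρ)]
  have hp : Integrable fun x : Phase n => (gaussianDensity t x : ℂ) :=
    (integrable_gaussianDensity ht).ofReal
  exact hp.smul_bdd ‖ρ‖
    (continuous_displace hρ htr).aestronglyMeasurable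
    (Filter.Eventually.of_forall fun x => norm_displace_le x ρ)

theorem trace_integral_gaussianDisplaced_ne_top (ht : 0 < t) (hρ : ρ.IsPositive)
    (htr : trace ρ ≠ ⊤) : trace (∫ x, gaussianDisplaced t ρ x) ≠ ⊤ := by
  refine ne_top_of_le_ne_top htr ((trace_integral_le (integrable_gaussianDisplaced ht hρ htr)
    (isPositive_gaussianDisplaced ht hρ)).trans_eq ?_)
  simp only [gaussianDisplaced_eq_smul, trace_smul (gaussianDensity_nonneg ht _), trace_displace _ hρ]
  rw [lintegral_mul_const _ continuous_gaussianDensity.measurable.ennreal_ofReal,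
    lintegral_gaussianDensity ht, one_mul]

/-- The heat semigroup acts on `A` only, hence it does not change the marginal on `M`. -/
theorem partialTrace_integral_gaussianDisplaced (ht : 0 < t) (hρ : ρ.IsPositive)
    (htr : trace ρ ≠ ⊤) : partialTrace (∫ x, gaussianDisplaced t ρ x) = partialTrace ρ := by
  have hpos := isPositive_gaussianDisplaced ht hρ
  have hint := integrable_gaussianDisplaced ht hρ htr
  have : Fact ((2 : ℝ≥0∞) ≠ ⊤) := ⟨ENNReal.ofNat_ne_top⟩
  refine eq_of_ofReal_re_inner_eq (isPositive_partialTrace (isPositive_integral hint hpos))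
    (isPositive_partialTrace hρ) fun u => ?_
  rw [ofReal_re_inner_partialTrace (isPositive_integral hint hpos)
      (trace_integral_gaussianDisplaced_ne_top ht hρ htr), ofReal_re_inner_partialTrace hρ htr,
    trace_adjoint_conj_integral hint hpos]
  simp only [gaussianDisplaced_eq_smul, ContinuousLinearMap.smul_comp, ContinuousLinearMap.comp_smul,
    trace_smul (gaussianDensity_nonneg ht _), trace_slice_displace _ hρ]
  rw [lintegral_mul_const _ continuous_gaussianDensity.measurable.ennreal_ofReal,
    lintegral_gaussianDensity ht, one_mul]

end Heat

/-! ### Entropies of the displaced state -/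

section DisplacedState

/-- The differential entropy of the Gaussian random variable on phase space, as a real number. Both
integrals are finite for `t > 0`, see `integrable_negMulLog_gaussianDensity`. -/
def gaussianEntropy (n : ℕ) (t : ℝ) : ℝ :=
  (∫⁻ x : Phase n, ENNReal.ofReal (max (Real.negMulLog (gaussianDensity t x)) 0)).toReal -
    (∫⁻ x : Phase n, ENNReal.ofReal (max (-Real.negMulLog (gaussianDensity t x)) 0)).toReal

theorem cqEntropy_gaussianDensity_smul {n : ℕ} {H : Type*} [NormedAddCommGroup H]
    [InnerProductSpace ℂ H] [CompleteSpace H] {t : ℝ} (ht : 0 < t) {τ : H →L[ℂ] H} (hτ : IsState τ) (hent : entropy τ ≠ ⊤)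
    {U : Phase n → (H →L[ℂ] H)} (hU : ∀ x, U x ∈ unitary (H →L[ℂ] H)) :
    cqEntropy (fun x => (gaussianDensity t x : ℂ) • (U x * τ * star (U x))) =
      (((entropy τ).toReal + gaussianEntropy n t : ℝ) : EReal) := by
  have h := integrable_negMulLog_gaussianDensity (n := n) ht
  exact cqEntropy_smul_unitary_conj continuous_gaussianDensity.measurable
    (gaussianDensity_nonneg ht) (lintegral_gaussianDensity ht)
    h.pos_part.lintegral_lt_top.ne h.neg_part.lintegral_lt_top.ne hτ hent hU

end DisplacedState

end QuantumDeBruijn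

end

theorem mainTheorem7 (n : ℕ) {HM : Type*} [NormedAddCommGroup HM] [InnerProductSpace ℂ HM]
    [CompleteSpace HM]
    (ρ : QuantumDeBruijn.Joint n HM →L[ℂ] QuantumDeBruijn.Joint n HM)
    (hρ : QuantumDeBruijn.IsState ρ)
    (hAM : QuantumDeBruijn.entropy ρ ≠ ⊤)
    (hM : QuantumDeBruijn.entropy (QuantumDeBruijn.partialTrace ρ) ≠ ⊤)
    (t : ℝ) (ht : 0 ≤ t) :
    QuantumDeBruijn.integralFisherInfo ρ t =
      QuantumDeBruijn.condEntropy (QuantumDeBruijn.heat t ρ) - QuantumDeBruijn.condEntropy ρ := by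
  open QuantumDeBruijn in
  have hcond : condEntropy ρ =
      (((entropy ρ).toReal - (entropy (partialTrace ρ)).toReal : ℝ) : EReal) := by
    rw [condEntropy, ← EReal.coe_ennreal_toReal hAM, ← EReal.coe_ennreal_toReal hM, EReal.coe_sub]
  rcases ht.eq_or_lt with rfl | ht
  · rw [integralFisherInfo, heat, if_pos rfl, if_pos rfl, hcond, ← EReal.coe_sub, sub_self,
      EReal.coe_zero]
  have htr : trace ρ ≠ ⊤ := by
    rw [hρ.2]
    exact ENNReal.one_ne_top
  have hheat : heat t ρ = ∫ x, gaussianDisplaced t ρ x := by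
    rw [heat, if_neg ht.ne']
    rfl
  have hρM : IsState (partialTrace ρ) :=
    ⟨isPositive_partialTrace hρ.1, by rw [trace_partialTrace hρ.1 htr, hρ.2]⟩
  have hcqAM : cqEntropy (gaussianDisplaced t ρ) =
      (((entropy ρ).toReal + gaussianEntropy n t : ℝ) : EReal) := by
    rw [← cqEntropy_gaussianDensity_smul ht hρ hAM (U := fun x => displacement x)
      fun x => displacement_mem_unitary x]
    exact congrArg cqEntropy (funext fun x => by rw [gaussianDisplaced_eq_smul, displace_eq_conj])
  have hcqM : cqEntropy (fun x => partialTrace (gaussianDisplaced t ρ x)) =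
      (((entropy (partialTrace ρ)).toReal + gaussianEntropy n t : ℝ) : EReal) := by
    rw [← cqEntropy_gaussianDensity_smul ht hρM hM (U := fun _ => 1) fun _ => one_mem _]
    congr 1
    funext x
    rw [gaussianDisplaced_eq_smul, partialTrace_smul, partialTrace_displace x hρ.1 htr, star_one,
      one_mul, mul_one]
  -- `S(M)` and `h(p_t)` are finite and cancel; only the entropy of the output may be infinite
  rw [integralFisherInfo, if_neg ht.ne', condMutualInfo, hcqAM, hcqM,
    partialTrace_integral_gaussianDisplaced ht hρ.1 htr, hcond, hheat,
    ← EReal.coe_ennreal_toReal hM, ← EReal.coe_sub, ← EReal.coe_sub, sub_eq_add_neg, add_assoc,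
    ← EReal.coe_neg, ← EReal.coe_add, sub_eq_add_neg (condEntropy _),
    ← EReal.coe_neg]
  congr 2
  ring
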